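/- Let $N\ge 2$, let $\Omega\subset\mathbb R^N$ be open and bounded, and let $p>1$ be a real number. Let $W^{1,p}_0(\Omega)$ be the closure of $C_c^\infty(\Omega)$ in $W^{1,p}(\Omega)$, with the norm $\|u\|_W=|\nabla u|_p$, where $|\cdot|_r$ is the norm of $L^r(\Omega)$, and let $X=W^{1,p}_0(\Omega)\cap L^\infty(\Omega)$, with the norm $\|u\|_X=\|u\|_W+|u|_\infty$ and with dual space $(X',\|\cdot\|_{X'})$. Let $A:\Omega\times\mathbb R\times\mathbb R^N\to\mathbb R$ be a $C^1$ Carathéodory function, i.e. $A(\cdot,t,\xi)$ is measurable for all $(t,\xi)$ and $A(x,\cdot,\cdot)$ is $C^1$ for a.e. $x\in\Omega$. Put $A_t=\partial A/\partial t$ and $a=(\partial A/\partial\xi_1,\dots,\partial A/\partial\xi_N)$, and suppose that there are positive continuous functions $\Phi_i,\phi_i:\mathbb R\to\mathbb R$, $i\in\{0,1,2\}$, such that for a.e. $x\in\Omega$ and all $(t,\xi)\in\mathbb R\times\mathbb R^N$ $$|A(x,t,\xi)|\le\Phi_0(t)+\phi_0(t)|\xi|^p,\quad |A_t(x,t,\xi)|\le\Phi_1(t)+\phi_1(t)|\xi|^p,\quad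 |a(x,t,\xi)|\le\Phi_2(t)+\phi_2(t)|\xi|^{p-1}.$$ Let $g:\Omega\times\mathbb R\to\mathbb R$ be a Carathéodory function, i.e. $g(\cdot,t)$ is measurable for all $t$ and $g(x,\cdot)$ is continuous for a.e. $x\in\Omega$, and suppose that there are $a_1,a_2>0$ and $q\ge1$ (with no upper bound on $q$) such that $|g(x,t)|\le a_1+a_2|t|^{q-1}$ for a.e. $x\in\Omega$ and all $t\in\mathbb R$. Put $G(x,t)=\int_0^t g(x,s)\,ds$. For $u,v\in X$ put $$J(u)=\int_\Omega A(x,u,\nabla u)\,dx-\int_\Omega G(x,u)\,dx,$$ $$\langle dJ(u),v\rangle=\int_\Omega\big(a(x,u,\nabla u)\cdot\nabla v+A_t(x,u,\nabla u)\,v\big)\,dx-\int_\Omega g(x,u)\,v\,dx .$$ Then all these integrals converge, and $dJ(u)\in X'$ for every $u\in X$. If $(u_n)_n\subset X$ and $u\in X$ are such that $\|u_n-u\|_W\to0$, $u_n\to u$ a.e. in $\Omega$, and $|u_n|_\infty\le M$ for all $n$ with some $M>0$, then $J(u_n)\to J(u)$ and $\|dJ(u_n)-dJ(u)\|_{X'}\to0$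 as $n\to\infty$. Moreover, $J$ is a $C^1$ functional on $X$ whose Fréchet differential at each $u\in X$ is $dJ(u)$. -/

import Mathlib

open MeasureTheory Filter Topology
open scoped ENNReal ContDiff

noncomputable section

/-- The Euclidean space `ℝ^N`. -/
abbrev Euc (N : ℕ) : Type := EuclideanSpace ℝ (Fin N)

/-- For a real exponent `p > 1` the spaces `L^p` are normed spaces. -/
instance factOneLeOfReal (p : ℝ) [hp : Fact (1 < p)] : Fact (1 ≤ ENNReal.ofReal p) :=
  ⟨ENNReal.one_le_ofReal.mpr hp.out.le⟩

/-- `Lebesgue measure on Ω`, as a measure on `ℝ^N`. -/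
abbrev volOn {N : ℕ} (Ω : Set (Euc N)) : Measure (Euc N) := volume.restrict Ω

/-- `φ ∈ C_c^∞(Ω)`. -/
structure IsTestFunction {N : ℕ} (Ω : Set (Euc N)) (φ : Euc N → ℝ) : Prop where
  smooth : ContDiff ℝ ∞ φ
  compact : HasCompactSupport φ
  support : tsupport φ ⊆ Ω

/-- `F` is the weak gradient of `u` in `Ω`. -/
def IsWeakGradient {N : ℕ} (Ω : Set (Euc N)) (u : Euc N → ℝ) (F : Euc N → Euc N) : Prop :=
  ∀ φ : Euc N → ℝ, IsTestFunction Ω φ →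
    ∫ x, u x • gradient φ x ∂(volOn Ω) = - ∫ x, φ x • F x ∂(volOn Ω)

section helpers

variable {N : ℕ} {Ω : Set (Euc N)}

theorem gradient_add_of_smooth {φ ψ : Euc N → ℝ} (hφ : ContDiff ℝ ∞ φ) (hψ : ContDiff ℝ ∞ ψ)
    (x : Euc N) :
    gradient (fun y => φ y + ψ y) x = gradient φ x + gradient ψ x := by
  have h1 : DifferentiableAt ℝ φ x := hφ.differentiable (by simp) x
  have h2 : DifferentiableAt ℝ ψ x := hψ.differentiable (by simp) x
  have h : fderiv ℝ (fun y => φ y + ψ y) x = fderiv ℝ φ x + fderiv ℝ ψ x := fderiv_add h1 h2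
  simp only [gradient, h, map_add]

theorem gradient_smul_of_smooth {φ : Euc N → ℝ} (hφ : ContDiff ℝ ∞ φ) (c : ℝ) (x : Euc N) :
    gradient (fun y => c * φ y) x = c • gradient φ x := by
  have h1 : DifferentiableAt ℝ φ x := hφ.differentiable (by simp) x
  have h : fderiv ℝ (fun y => c * φ y) x = c • fderiv ℝ φ x := fderiv_const_mul h1 c
  simp only [gradient, h, map_smul]

theorem IsTestFunction.continuous_gradient {φ : Euc N → ℝ} (hφ : IsTestFunction Ω φ) :
    Continuous (gradient φ) :=
  (InnerProductSpace.toDual ℝ (Euc N)).symm.continuous.comp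
    (hφ.smooth.continuous_fderiv (by simp))

theorem IsTestFunction.compact_gradient {φ : Euc N → ℝ} (hφ : IsTestFunction Ω φ) :
    HasCompactSupport (gradient φ) :=
  (hφ.compact.fderiv (𝕜 := ℝ)).comp_left
    (g := (InnerProductSpace.toDual ℝ (Euc N)).symm) (map_zero _)

theorem IsTestFunction.integrable_smul_gradient {φ : Euc N → ℝ} (hφ : IsTestFunction Ω φ)
    {p : ℝ≥0∞} (hp : 1 ≤ p) {u : Euc N → ℝ} (hu : MemLp u p (volOn Ω)) :
    Integrable (fun x => u x • gradient φ x) (volOn Ω) :=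
  (hu.locallyIntegrable hp).integrable_smul_right_of_hasCompactSupport
    hφ.continuous_gradient hφ.compact_gradient

theorem IsTestFunction.integrable_smul {φ : Euc N → ℝ} (hφ : IsTestFunction Ω φ)
    {p : ℝ≥0∞} (hp : 1 ≤ p) {F : Euc N → Euc N} (hF : MemLp F p (volOn Ω)) :
    Integrable (fun x => φ x • F x) (volOn Ω) :=
  (hF.locallyIntegrable hp).integrable_smul_left_of_hasCompactSupport
    hφ.smooth.continuous hφ.compact

end helpers

/-- The Sobolev space `W^{1,p}(Ω)`: a function is represented by the pair `(u, ∇u)` of its class in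
`L^p(Ω)` and its weak gradient in `L^p(Ω; ℝ^N)` (which is determined by `u`). -/
def sobolevW1 {N : ℕ} (Ω : Set (Euc N)) (p : ℝ) [Fact (1 < p)] :
    Submodule ℝ (Lp ℝ (ENNReal.ofReal p) (volOn Ω) × Lp (Euc N) (ENNReal.ofReal p) (volOn Ω)) where
  carrier := {z | IsWeakGradient Ω z.1 z.2}
  zero_mem' := by
    intro φ _
    rw [integral_eq_zero_of_ae, integral_eq_zero_of_ae, neg_zero]
    · filter_upwards [Lp.coeFn_zero (Euc N) (ENNReal.ofReal p) (volOn Ω)] with x hx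
      rw [Prod.snd_zero, hx]
      simp
    · filter_upwards [Lp.coeFn_zero ℝ (ENNReal.ofReal p) (volOn Ω)] with x hx
      rw [Prod.fst_zero, hx]
      simp
  add_mem' := by
    intro z w hz hw φ hφ
    have h1 : (1 : ℝ≥0∞) ≤ ENNReal.ofReal p := Fact.out
    have e1 : ∫ x, (z + w).1 x • gradient φ x ∂(volOn Ω)
        = ∫ x, (z.1 x • gradient φ x + w.1 x • gradient φ x) ∂(volOn Ω) := by
      apply integral_congr_ae
      filter_upwards [Lp.coeFn_add z.1 w.1] with x hx
      rw [Prod.fst_add, hx, Pi.add_apply, add_smul]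
    have e2 : ∫ x, φ x • (z + w).2 x ∂(volOn Ω)
        = ∫ x, (φ x • z.2 x + φ x • w.2 x) ∂(volOn Ω) := by
      apply integral_congr_ae
      filter_upwards [Lp.coeFn_add z.2 w.2] with x hx
      rw [Prod.snd_add, hx, Pi.add_apply, smul_add]
    rw [e1, e2, integral_add (hφ.integrable_smul_gradient h1 (Lp.memLp z.1))
        (hφ.integrable_smul_gradient h1 (Lp.memLp w.1)),
      integral_add (hφ.integrable_smul h1 (Lp.memLp z.2)) (hφ.integrable_smul h1 (Lp.memLp w.2)),
      hz φ hφ, hw φ hφ, neg_add]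
  smul_mem' := by
    intro c z hz φ hφ
    have e1 : ∫ x, (c • z).1 x • gradient φ x ∂(volOn Ω)
        = ∫ x, c • (z.1 x • gradient φ x) ∂(volOn Ω) := by
      apply integral_congr_ae
      filter_upwards [Lp.coeFn_smul c z.1] with x hx
      rw [Prod.smul_fst, hx, Pi.smul_apply, smul_assoc]
    have e2 : ∫ x, φ x • (c • z).2 x ∂(volOn Ω) = ∫ x, c • (φ x • z.2 x) ∂(volOn Ω) := by
      apply integral_congr_ae
      filter_upwards [Lp.coeFn_smul c z.2] with x hx
      rw [Prod.smul_snd, hx, Pi.smul_apply, smul_comm]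
    rw [e1, e2, integral_smul, integral_smul, hz φ hφ, smul_neg]

/-- The test functions `C_c^∞(Ω)`, as pairs `(φ, ∇φ)`. -/
def testSpace {N : ℕ} (Ω : Set (Euc N)) (p : ℝ) [Fact (1 < p)] :
    Submodule ℝ (Lp ℝ (ENNReal.ofReal p) (volOn Ω) × Lp (Euc N) (ENNReal.ofReal p) (volOn Ω)) where
  carrier := {z | ∃ φ : Euc N → ℝ, IsTestFunction Ω φ ∧
    z.1 =ᵐ[volOn Ω] φ ∧ z.2 =ᵐ[volOn Ω] gradient φ}
  zero_mem' := by
    refine ⟨fun _ => 0, ⟨contDiff_const, HasCompactSupport.zero, by simp [tsupport]⟩, ?_, ?_⟩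
    · filter_upwards [Lp.coeFn_zero ℝ (ENNReal.ofReal p) (volOn Ω)] with x hx
      simpa using hx
    · filter_upwards [Lp.coeFn_zero (Euc N) (ENNReal.ofReal p) (volOn Ω)] with x hx
      have : gradient (fun _ : Euc N => (0 : ℝ)) x = 0 := by simp [gradient]
      simpa [this] using hx
  add_mem' := by
    rintro z w ⟨φ, hφ, h1, h2⟩ ⟨ψ, hψ, h3, h4⟩
    refine ⟨fun x => φ x + ψ x, ⟨hφ.smooth.add hψ.smooth, hφ.compact.add hψ.compact,
      (tsupport_add φ ψ).trans (Set.union_subset hφ.support hψ.support)⟩, ?_, ?_⟩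
    · filter_upwards [Lp.coeFn_add z.1 w.1, h1, h3] with x hx hx1 hx3
      rw [Prod.fst_add, hx, Pi.add_apply, hx1, hx3]
    · filter_upwards [Lp.coeFn_add z.2 w.2, h2, h4] with x hx hx2 hx4
      rw [Prod.snd_add, hx, Pi.add_apply, hx2, hx4, gradient_add_of_smooth hφ.smooth hψ.smooth]
  smul_mem' := by
    rintro c z ⟨φ, hφ, h1, h2⟩
    refine ⟨fun x => c * φ x, ⟨contDiff_const.mul hφ.smooth, hφ.compact.mul_left,
      (tsupport_mul_subset_right (f := fun _ => c) (g := φ)).trans hφ.support⟩, ?_, ?_⟩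
    · filter_upwards [Lp.coeFn_smul c z.1, h1] with x hx hx1
      rw [Prod.smul_fst, hx, Pi.smul_apply, hx1, smul_eq_mul]
    · filter_upwards [Lp.coeFn_smul c z.2, h2] with x hx hx2
      rw [Prod.smul_snd, hx, Pi.smul_apply, hx2, gradient_smul_of_smooth hφ.smooth]

/-- `W^{1,p}_0(Ω)`: the closure of `C_c^∞(Ω)` in `W^{1,p}(Ω)`. -/
def sobolevW10 {N : ℕ} (Ω : Set (Euc N)) (p : ℝ) [Fact (1 < p)] :
    Submodule ℝ (Lp ℝ (ENNReal.ofReal p) (volOn Ω) × Lp (Euc N) (ENNReal.ofReal p) (volOn Ω)) :=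
  sobolevW1 Ω p ⊓ (testSpace Ω p).topologicalClosure

/-- The space `X = W^{1,p}_0(Ω) ∩ L^∞(Ω)`. An element `u` is represented by the pair `(∇u, u)` in
`L^p(Ω; ℝ^N) × L^∞(Ω)`; the norm inherited from the `ℓ^1`-product is
`‖u‖_X = |∇u|_p + |u|_∞`. -/
def spaceX {N : ℕ} (Ω : Set (Euc N)) (p : ℝ) [Fact (1 < p)] :
    Submodule ℝ (WithLp 1 (Lp (Euc N) (ENNReal.ofReal p) (volOn Ω) × Lp ℝ ∞ (volOn Ω))) where
  carrier := {w | ∃ z ∈ sobolevW10 Ω p, z.1 =ᵐ[volOn Ω] w.snd ∧ z.2 = w.fst}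
  zero_mem' := by
    refine ⟨0, Submodule.zero_mem _, ?_, rfl⟩
    filter_upwards [Lp.coeFn_zero ℝ (ENNReal.ofReal p) (volOn Ω), Lp.coeFn_zero ℝ ∞ (volOn Ω)]
      with x h1 h2
    rw [Prod.fst_zero, WithLp.zero_snd, h1, h2]
  add_mem' := by
    rintro w w' ⟨z, hz, h1, h2⟩ ⟨z', hz', h1', h2'⟩
    refine ⟨z + z', Submodule.add_mem _ hz hz', ?_, by simp [h2, h2']⟩
    filter_upwards [Lp.coeFn_add z.1 z'.1, Lp.coeFn_add w.snd w'.snd, h1, h1'] with x a b c d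
    rw [Prod.fst_add, WithLp.add_snd, a, b, Pi.add_apply, Pi.add_apply, c, d]
  smul_mem' := by
    rintro r w ⟨z, hz, h1, h2⟩
    refine ⟨r • z, Submodule.smul_mem _ r hz, ?_, by simp [h2]⟩
    filter_upwards [Lp.coeFn_smul r z.1, Lp.coeFn_smul r w.snd, h1] with x a b c
    rw [Prod.smul_fst, WithLp.smul_snd, a, b, Pi.smul_apply, Pi.smul_apply, c]

section elements

variable {N : ℕ} {Ω : Set (Euc N)} {p : ℝ} [Fact (1 < p)]

/-- The class of `u ∈ X` in `L^∞(Ω)`. -/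
def spaceX.val (u : spaceX Ω p) : Lp ℝ ∞ (volOn Ω) := u.1.snd

/-- The weak gradient `∇u ∈ L^p(Ω; ℝ^N)` of `u ∈ X`. -/
def spaceX.grad (u : spaceX Ω p) : Lp (Euc N) (ENNReal.ofReal p) (volOn Ω) :=
  u.1.fst

/-- `‖u‖_W = |∇u|_p`. -/
def normW (u : spaceX Ω p) : ℝ := ‖spaceX.grad u‖

/-- `|u|_∞`, the essential supremum of `|u|` over `Ω`. -/
def normInfty (u : spaceX Ω p) : ℝ := ‖spaceX.val u‖

theorem norm_spaceX (u : spaceX Ω p) : ‖u‖ = normW u + normInfty u :=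
  WithLp.prod_norm_eq_of_L1 u.1

end elements

/-- `C^1` Carathéodory functions `A(x, t, ξ)`; measurability is with respect to the Lebesgue
measurable sets of `Ω`. -/
structure IsC1Caratheodory {N : ℕ} (Ω : Set (Euc N)) (A : Euc N → ℝ → Euc N → ℝ) : Prop where
  measurable : ∀ (t : ℝ) (ξ : Euc N), AEMeasurable (fun x => A x t ξ) (volOn Ω)
  contDiff : ∀ᵐ x ∂(volOn Ω), ContDiff ℝ 1 (fun z : ℝ × Euc N => A x z.1 z.2)

/-- Carathéodory functions `g(x, t)`. -/
structure IsCaratheodory {N : ℕ} (Ω : Set (Euc N)) (g : Euc N → ℝ → ℝ) : Prop where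
  measurable : ∀ t : ℝ, AEMeasurable (fun x => g x t) (volOn Ω)
  continuous : ∀ᵐ x ∂(volOn Ω), Continuous (g x)

/-- `A_t = ∂A/∂t`. -/
def partialT {N : ℕ} (A : Euc N → ℝ → Euc N → ℝ) (x : Euc N) (t : ℝ) (ξ : Euc N) : ℝ :=
  deriv (fun s => A x s ξ) t

/-- `a = ∇_ξ A = (∂A/∂ξ_1, …, ∂A/∂ξ_N)`. -/
def gradXi {N : ℕ} (A : Euc N → ℝ → Euc N → ℝ) (x : Euc N) (t : ℝ) (ξ : Euc N) : Euc N :=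
  gradient (fun η => A x t η) ξ

/-- `G(x, t) = ∫_0^t g(x, s) ds`. -/
def primitiveG {N : ℕ} (g : Euc N → ℝ → ℝ) (x : Euc N) (t : ℝ) : ℝ :=
  ∫ s in (0 : ℝ)..t, g x s

/-- `J(u) = ∫_Ω A(x, u, ∇u) dx - ∫_Ω G(x, u) dx` on `X`. -/
def functionalJ {N : ℕ} {Ω : Set (Euc N)} {p : ℝ} [Fact (1 < p)]
    (A : Euc N → ℝ → Euc N → ℝ) (g : Euc N → ℝ → ℝ) (u : spaceX Ω p) : ℝ :=
  ∫ x, A x (spaceX.val u x) (spaceX.grad u x) ∂(volOn Ω)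
    - ∫ x, primitiveG g x (spaceX.val u x) ∂(volOn Ω)

/-- `⟨dJ(u), v⟩ = ∫_Ω (a(x, u, ∇u) · ∇v + A_t(x, u, ∇u) v) dx - ∫_Ω g(x, u) v dx`. -/
def differentialJ {N : ℕ} {Ω : Set (Euc N)} {p : ℝ} [Fact (1 < p)]
    (A : Euc N → ℝ → Euc N → ℝ) (g : Euc N → ℝ → ℝ) (u v : spaceX Ω p) : ℝ :=
  ∫ x, (inner ℝ (gradXi A x (spaceX.val u x) (spaceX.grad u x)) (spaceX.grad v x)
      + partialT A x (spaceX.val u x) (spaceX.grad u x) * spaceX.val v x) ∂(volOn Ω)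
    - ∫ x, g x (spaceX.val u x) * spaceX.val v x ∂(volOn Ω)

end

/-!
`J` is the difference of two energies `w ↦ ∫ H(x, w(x)) dx` on `L^∞ × L^p`, pulled back along the
continuous linear map `u ↦ (u, ∇u)`: one for `H = A`, the other for `G(x, t)`, regarded as an
integrand that does not depend on `ξ`.

If `F(x, t, ξ)` is Carathéodory and bounded by a multiple of `1 + |ξ|^s`, locally uniformly in `t`,
then `w ↦ F(·, w(·))` maps `L^∞ × L^p` to `L^{p/s}`. When `w_n = (u_n, ξ_n)` has `u_n` bounded in
`L^∞` and convergent in measure, and `ξ_n` convergent in `L^p`, the functions `F(·, w_n)` converge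
in measure and inherit uniform integrability from the convergent sequence `ξ_n`, so that they
converge in `L^{p/s}` by Vitali's theorem.

This applies to `H` with values in `L^1` and, for the differential, to `∂H/∂t` with values in `L^1`
and to `∂H/∂ξ` with values in `L^{p'}`; pairing these with `v ∈ L^∞ × L^p` by Hölder's inequality
gives a differential that is continuous in operator norm. Dominated convergence shows that it
computes the derivatives of the energy along lines, and by its continuity and the mean value
inequality it is then the Fréchet derivative.
-/

section Caratheodory

variable {α : Type*} [MeasurableSpace α] {μ : Measure α}

/-- Carathéodory maps: `F(x, z)` is measurable in `x` for every `z` and, for almost every `x`,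
continuous in `z`. Measurability in `x` is up to `μ`-null sets. -/
structure CaratheodoryMap {Z β : Type*} [TopologicalSpace Z] [TopologicalSpace β]
    (μ : Measure α) (F : α → Z → β) : Prop where
  measurable : ∀ z, AEStronglyMeasurable (fun x => F x z) μ
  continuous : ∀ᵐ x ∂μ, Continuous (F x)

namespace CaratheodoryMap

variable {Z β : Type*} [TopologicalSpace Z] [TopologicalSpace β] {F : α → Z → β}

theorem continuous_comp {γ : Type*} [TopologicalSpace γ] (hF : CaratheodoryMap μ F) {f : β → γ}
    (hf : Continuous f) : CaratheodoryMap μ (fun x z => f (F x z)) :=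
  ⟨fun z => hf.comp_aestronglyMeasurable (hF.measurable z),
    hF.continuous.mono fun _ hx => hf.comp hx⟩

variable [TopologicalSpace.PseudoMetrizableSpace β]

theorem comp_simpleFunc (hF : CaratheodoryMap μ F) (f : SimpleFunc α Z) :
    AEStronglyMeasurable (fun x => F x (f x)) μ := by
  have cover : (⋃ z : f.range, f ⁻¹' {(z : Z)}) = Set.univ := by
    ext x
    simp
  rw [← Measure.restrict_univ (μ := μ), ← cover]
  refine aestronglyMeasurable_iUnion_iff.2 fun z => ?_
  refine ((hF.measurable z).mono_measure Measure.restrict_le_self).congr ?_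
  filter_upwards [ae_restrict_mem (f.measurableSet_preimage {(z : Z)})] with x hx
  rw [show f x = z from hx]

theorem comp_aestronglyMeasurable (hF : CaratheodoryMap μ F) {w : α → Z}
    (hw : AEStronglyMeasurable w μ) : AEStronglyMeasurable (fun x => F x (w x)) μ := by
  have comp_mk : AEStronglyMeasurable (fun x => F x (hw.mk w x)) μ := by
    refine aestronglyMeasurable_of_tendsto_ae atTop
      (f := fun n x => F x (hw.stronglyMeasurable_mk.approx n x))
      (fun n => hF.comp_simpleFunc _) ?_
    filter_upwards [hF.continuous] with x hx
    exact (hx.tendsto _).comp (hw.stronglyMeasurable_mk.tendsto_approx x)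
  refine comp_mk.congr ?_
  filter_upwards [hw.ae_eq_mk] with x hx
  rw [hx]

theorem tendstoInMeasure [IsFiniteMeasure μ] {Z β : Type*} [PseudoEMetricSpace Z]
    [PseudoEMetricSpace β] {F : α → Z → β} (hF : CaratheodoryMap μ F) {w : ℕ → α → Z} {w₀ : α → Z}
    (hw : ∀ n, AEStronglyMeasurable (w n) μ) (hlim : TendstoInMeasure μ w atTop w₀) :
    TendstoInMeasure μ (fun n x => F x (w n x)) atTop (fun x => F x (w₀ x)) := by
  rw [exists_seq_tendstoInMeasure_atTop_iff fun n => hF.comp_aestronglyMeasurable (hw n)]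
  intro ns hns
  obtain ⟨ms, hms, hae⟩ := (hlim.comp hns.tendsto_atTop).exists_seq_tendsto_ae
  refine ⟨ms, hms, ?_⟩
  filter_upwards [hF.continuous, hae] with x hx hwx
  exact (hx.tendsto _).comp hwx

end CaratheodoryMap

variable {V G : Type*} [NormedAddCommGroup V] [NormedSpace ℝ V]
  [NormedAddCommGroup G] [NormedSpace ℝ G]

theorem aestronglyMeasurable_clm_of_apply [FiniteDimensional ℝ V] {f : α → V →L[ℝ] G}
    (hf : ∀ v, AEStronglyMeasurable (fun x => f x v) μ) : AEStronglyMeasurable f μ := by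
  let b := Module.finBasis ℝ V
  have expansion (x : α) : ∑ i, (b.coord i).toContinuousLinearMap.smulRight (f x (b i)) = f x := by
    ext v
    conv_rhs => rw [← b.sum_repr v, map_sum]
    simp
  refine (Finset.aestronglyMeasurable_fun_sum Finset.univ fun i _ => ?_).congr
    (.of_forall expansion)
  exact (ContinuousLinearMap.smulRightL ℝ V G (b.coord i).toContinuousLinearMap).continuous
    |>.comp_aestronglyMeasurable (hf (b i))

theorem aestronglyMeasurable_fderiv_apply {F : α → V → G}
    (hF : ∀ z, AEStronglyMeasurable (fun x => F x z) μ) {z : V}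
    (hdiff : ∀ᵐ x ∂μ, DifferentiableAt ℝ (F x) z) (v : V) :
    AEStronglyMeasurable (fun x => fderiv ℝ (F x) z v) μ := by
  refine aestronglyMeasurable_of_tendsto_ae atTop
    (f := fun (n : ℕ) x => (n : ℝ) • (F x (z + (n : ℝ)⁻¹ • v) - F x z))
    (fun n => ((hF _).sub (hF z)).const_smul (n : ℝ)) ?_
  filter_upwards [hdiff] with x hx
  exact hx.hasFDerivAt.lim v (by simpa using tendsto_natCast_atTop_atTop)

theorem CaratheodoryMap.fderiv [FiniteDimensional ℝ V] {F : α → V → G}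
    (hF : ∀ z, AEStronglyMeasurable (fun x => F x z) μ)
    (hdiff : ∀ᵐ x ∂μ, ContDiff ℝ 1 (F x)) : CaratheodoryMap μ (fun x => fderiv ℝ (F x)) where
  measurable z := aestronglyMeasurable_clm_of_apply <| aestronglyMeasurable_fderiv_apply hF <|
    hdiff.mono fun _ hx => hx.differentiable one_ne_zero z
  continuous := hdiff.mono fun _ hx => hx.continuous_fderiv one_ne_zero

end Caratheodory

section UniformIntegrability

variable {α ι G : Type*} [MeasurableSpace α] {μ : Measure α} [NormedAddCommGroup G]

theorem tendstoInMeasure_prodMk {β γ : Type*} [PseudoEMetricSpace β] [PseudoEMetricSpace γ]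
    {l : Filter ι} {u : ι → α → β} {u₀ : α → β} {v : ι → α → γ} {v₀ : α → γ}
    (hu : TendstoInMeasure μ u l u₀) (hv : TendstoInMeasure μ v l v₀) :
    TendstoInMeasure μ (fun i x => (u i x, v i x)) l (fun x => (u₀ x, v₀ x)) := by
  intro ε hε
  refine tendsto_of_tendsto_of_tendsto_of_le_of_le tendsto_const_nhds
    (by simpa using (hu ε hε).add (hv ε hε)) (fun _ => zero_le) fun i => ?_
  refine (measure_mono fun x hx => ?_).trans (measure_union_le _ _)
  simpa only [Set.mem_union, Set.mem_ofPred_eq, Prod.edist_eq, le_max_iff] using hx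

theorem unifIntegrable_of_norm_le_mul {G' : Type*} [NormedAddCommGroup G'] {r : ℝ≥0∞}
    {f : ι → α → G} {g : ι → α → G'} {C : ℝ} (hg : UnifIntegrable g r μ)
    (hfg : ∀ i, ∀ᵐ x ∂μ, ‖f i x‖ ≤ C * ‖g i x‖) : UnifIntegrable f r μ := by
  intro ε hε
  have hC : 0 < max C 1 := lt_max_of_lt_right one_pos
  obtain ⟨δ, hδ, hgδ⟩ := hg (div_pos hε hC)
  refine ⟨δ, hδ, fun i s hs hμs => ?_⟩
  have hle : ∀ᵐ x ∂μ, ‖s.indicator (f i) x‖ ≤ max C 1 * ‖s.indicator (g i) x‖ := by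
    filter_upwards [hfg i] with x hx
    by_cases hxs : x ∈ s
    · simpa only [Set.indicator_of_mem hxs] using hx.trans (by gcongr; exact le_max_left _ _)
    · simp [hxs]
  calc eLpNorm (s.indicator (f i)) r μ
      ≤ ENNReal.ofReal (max C 1) * eLpNorm (s.indicator (g i)) r μ :=
        eLpNorm_le_mul_eLpNorm_of_ae_le_mul hle r
    _ ≤ ENNReal.ofReal (max C 1) * ENNReal.ofReal (ε / max C 1) := by
        gcongr
        exact hgδ i s hs hμs
    _ = ENNReal.ofReal ε := by
        rw [← ENNReal.ofReal_mul hC.le, mul_div_cancel₀ _ hC.ne']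

theorem unifIntegrable_norm_rpow {P R : ℝ≥0∞} {s : ℝ} (hs : 0 < s)
    (hPR : R * ENNReal.ofReal s = P) {f : ι → α → G} (hf : UnifIntegrable f P μ) :
    UnifIntegrable (fun i x => ‖f i x‖ ^ s) R μ := by
  intro ε hε
  obtain ⟨δ, hδ, hfδ⟩ := hf (Real.rpow_pos_of_pos hε s⁻¹)
  refine ⟨δ, hδ, fun i t ht hμt => ?_⟩
  have indicator_rpow :
      t.indicator (fun x => ‖f i x‖ ^ s) = fun x => ‖t.indicator (f i) x‖ ^ s := by
    ext x
    by_cases hx : x ∈ t <;> simp [hx, hs.ne']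
  calc eLpNorm (t.indicator fun x => ‖f i x‖ ^ s) R μ
      = eLpNorm (t.indicator (f i)) P μ ^ s := by
        rw [indicator_rpow, eLpNorm_norm_rpow _ hs, hPR]
    _ ≤ ENNReal.ofReal (ε ^ s⁻¹) ^ s := by
        gcongr
        exact hfδ i t ht hμt
    _ = ENNReal.ofReal ε := by
        rw [ENNReal.ofReal_rpow_of_pos (Real.rpow_pos_of_pos hε _), Real.rpow_inv_rpow hε.le hs.ne']

theorem memLp_norm_rpow {P R : ℝ≥0∞} {s : ℝ} (hs : 0 < s) (hPR : R * ENNReal.ofReal s = P)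
    {f : α → G} (hf : MemLp f P μ) : MemLp (fun x => ‖f x‖ ^ s) R μ := by
  have h := hf.norm_rpow_div (ENNReal.ofReal s)
  rwa [ENNReal.toReal_ofReal hs.le, ← hPR, ENNReal.mul_div_cancel_right
    (ENNReal.ofReal_pos.2 hs).ne' ENNReal.ofReal_ne_top] at h

theorem ae_norm_le_norm_Lp_top (f : Lp G ∞ μ) : ∀ᵐ x ∂μ, ‖f x‖ ≤ ‖f‖ := by
  rw [Lp.norm_def, toReal_eLpNorm (Lp.aestronglyMeasurable f)]
  exact ae_le_lpNorm_exponent_top (Lp.memLp f)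

theorem integrable_Lp_apply {V : Type*} [NormedAddCommGroup V] [NormedSpace ℝ V] {P Q : ℝ≥0∞}
    [P.HolderConjugate Q] (f : Lp (V →L[ℝ] ℝ) P μ) (g : Lp V Q μ) :
    Integrable (fun x => f x (g x)) μ :=
  memLp_one_iff_integrable.1 <|
    (ContinuousLinearMap.id ℝ (V →L[ℝ] ℝ)).memLp_of_bilin 1 (Lp.memLp f) (Lp.memLp g)

end UniformIntegrability

section Growth

variable {α T E G : Type*} [MeasurableSpace α] {μ : Measure α} [NormedAddCommGroup T]
  [NormedAddCommGroup E] [NormedAddCommGroup G]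

/-- `F(x, t, ξ)` has growth of order `s` in `ξ`, locally uniformly in `t`: for `‖t‖ ≤ M` it is
bounded by a multiple of `1 + ‖ξ‖ ^ s`. -/
def HasGrowth (μ : Measure α) (F : α → T × E → G) (s : ℝ) : Prop :=
  ∀ M : ℝ, ∃ K : ℝ, 0 ≤ K ∧
    ∀ᵐ x ∂μ, ∀ t ξ, ‖t‖ ≤ M → ‖F x (t, ξ)‖ ≤ K * (1 + ‖ξ‖ ^ s)

theorem hasGrowth_of_norm_le [ProperSpace T] {F : α → T × E → G} {s : ℝ} {Φ φ : T → ℝ}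
    (hΦ : Continuous Φ) (hφ : Continuous φ)
    (hF : ∀ᵐ x ∂μ, ∀ t ξ, ‖F x (t, ξ)‖ ≤ Φ t + φ t * ‖ξ‖ ^ s) : HasGrowth μ F s := by
  intro M
  obtain ⟨C, hC⟩ := (isCompact_closedBall (0 : T) M).exists_bound_of_continuousOn hΦ.continuousOn
  obtain ⟨c, hc⟩ := (isCompact_closedBall (0 : T) M).exists_bound_of_continuousOn hφ.continuousOn
  refine ⟨max C c ⊔ 0, le_max_right _ _, ?_⟩
  filter_upwards [hF] with x hx t ξ ht
  have ht' : t ∈ Metric.closedBall (0 : T) M := mem_closedBall_zero_iff.2 ht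
  have hΦt : Φ t ≤ max C c ⊔ 0 :=
    (le_abs_self _).trans <| (hC t ht').trans <| (le_max_left _ _).trans (le_max_left _ _)
  have hφt : φ t ≤ max C c ⊔ 0 :=
    (le_abs_self _).trans <| (hc t ht').trans <| (le_max_right _ _).trans (le_max_left _ _)
  calc ‖F x (t, ξ)‖ ≤ Φ t + φ t * ‖ξ‖ ^ s := hx t ξ
    _ ≤ (max C c ⊔ 0) + (max C c ⊔ 0) * ‖ξ‖ ^ s := by gcongr
    _ = (max C c ⊔ 0) * (1 + ‖ξ‖ ^ s) := by ring

/-- Pairs `(t, ξ)` of a bounded function and an `L^P` function, the arguments of Nemytskii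
operators. -/
abbrev LpPair (T E : Type*) [NormedAddCommGroup T] [NormedAddCommGroup E] (P : ℝ≥0∞)
    (μ : Measure α) : Type _ :=
  Lp T ∞ μ × Lp E P μ

theorem LpPair.aestronglyMeasurable {P : ℝ≥0∞} (w : LpPair T E P μ) :
    AEStronglyMeasurable (fun x => (w.1 x, w.2 x)) μ :=
  (Lp.aestronglyMeasurable w.1).prodMk (Lp.aestronglyMeasurable w.2)

theorem LpPair.coeFn_add_smul [NormedSpace ℝ T] [NormedSpace ℝ E] {P : ℝ≥0∞}
    (w v : LpPair T E P μ) (s : ℝ) :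
    (fun x => ((w + s • v).1 x, (w + s • v).2 x)) =ᵐ[μ]
      fun x => (w.1 x, w.2 x) + s • (v.1 x, v.2 x) := by
  filter_upwards [Lp.coeFn_add w.1 (s • v.1), Lp.coeFn_add w.2 (s • v.2),
    Lp.coeFn_smul s v.1, Lp.coeFn_smul s v.2] with x add₁ add₂ smul₁ smul₂
  simp only [Prod.fst_add, Prod.snd_add, Prod.smul_fst, Prod.smul_snd, add₁, add₂, smul₁, smul₂,
    Pi.add_apply, Pi.smul_apply, Prod.smul_mk, Prod.mk_add_mk]

/-- Convergence of the first components boundedly in measure and of the second ones in `L^P`. It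
is weaker than convergence in norm, and strong enough for Nemytskii operators to be continuous. -/
structure TendstoBounded {P : ℝ≥0∞} [Fact (1 ≤ P)] (w : ℕ → LpPair T E P μ)
    (w₀ : LpPair T E P μ) : Prop where
  bounded : ∃ M : ℝ, ∀ n, ‖(w n).1‖ ≤ M
  fst : TendstoInMeasure μ (fun n => (w n).1) atTop w₀.1
  snd : Tendsto (fun n => (w n).2) atTop (𝓝 w₀.2)

theorem tendstoBounded_of_tendsto {P : ℝ≥0∞} [Fact (1 ≤ P)] {w : ℕ → LpPair T E P μ}
    {w₀ : LpPair T E P μ} (hw : Tendsto w atTop (𝓝 w₀)) : TendstoBounded w w₀ where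
  bounded := by
    obtain ⟨M, hM⟩ := hw.fst_nhds.norm.bddAbove_range
    exact ⟨M, fun n => hM (Set.mem_range_self n)⟩
  fst := tendstoInMeasure_of_tendsto_Lp hw.fst_nhds
  snd := hw.snd_nhds

theorem TendstoBounded.tendstoInMeasure_prodMk {P : ℝ≥0∞} [Fact (1 ≤ P)]
    {w : ℕ → LpPair T E P μ} {w₀ : LpPair T E P μ} (hw : TendstoBounded w w₀) :
    TendstoInMeasure μ (fun n x => ((w n).1 x, (w n).2 x)) atTop (fun x => (w₀.1 x, w₀.2 x)) :=
  _root_.tendstoInMeasure_prodMk hw.fst (tendstoInMeasure_of_tendsto_Lp hw.snd)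

theorem norm_add_smul_le [NormedSpace ℝ E] (a b : E) {s : ℝ} (hs : |s| ≤ 1) :
    ‖a + s • b‖ ≤ ‖a‖ + ‖b‖ :=
  norm_add_le_of_le le_rfl <| (norm_smul_le s b).trans <| mul_le_of_le_one_left (norm_nonneg b) hs

end Growth

section Nemytskii

variable {α T E G : Type*} [MeasurableSpace α] {μ : Measure α} [NormedAddCommGroup T]
  [NormedAddCommGroup E] [NormedAddCommGroup G]

/-- Carathéodory maps of growth of order `s`. They act by superposition `w ↦ F(·, w(·))` from
`L^∞ × L^P` to `L^R` whenever `R * s = P`. -/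
structure IsNemytskii (μ : Measure α) (F : α → T × E → G) (s : ℝ) : Prop extends
    CaratheodoryMap μ F where
  growth : HasGrowth μ F s

namespace IsNemytskii

variable [IsFiniteMeasure μ] {F : α → T × E → G} {s : ℝ} {P R : ℝ≥0∞}

theorem memLp (hF : IsNemytskii μ F s) (hs : 0 < s) (hPR : R * ENNReal.ofReal s = P)
    (w : LpPair T E P μ) : MemLp (fun x => F x (w.1 x, w.2 x)) R μ := by
  obtain ⟨K, -, hK⟩ := hF.growth ‖w.1‖
  have dominating : MemLp (fun x => 1 + ‖w.2 x‖ ^ s) R μ :=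
    (memLp_const (1 : ℝ)).add (memLp_norm_rpow hs hPR (Lp.memLp w.2))
  refine dominating.of_le_mul (c := K) (hF.comp_aestronglyMeasurable w.aestronglyMeasurable) ?_
  filter_upwards [hK, ae_norm_le_norm_Lp_top w.1] with x hx hwx
  exact (hx _ _ hwx).trans_eq (by rw [Real.norm_of_nonneg (by positivity)])

/-- The superposition operator `w ↦ F(·, w(·))` from `L^∞ × L^P` to `L^R`. -/
noncomputable def toLp (hF : IsNemytskii μ F s) (hs : 0 < s) (hPR : R * ENNReal.ofReal s = P)
    (w : LpPair T E P μ) : Lp G R μ :=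
  (hF.memLp hs hPR w).toLp _

theorem coeFn_toLp (hF : IsNemytskii μ F s) (hs : 0 < s) (hPR : R * ENNReal.ofReal s = P)
    (w : LpPair T E P μ) : hF.toLp hs hPR w =ᵐ[μ] fun x => F x (w.1 x, w.2 x) :=
  MemLp.coeFn_toLp _

variable [Fact (1 ≤ P)] {w : ℕ → LpPair T E P μ} {w₀ : LpPair T E P μ}

theorem unifIntegrable (hF : IsNemytskii μ F s) (hs : 0 < s) (hPR : R * ENNReal.ofReal s = P)
    (hR : 1 ≤ R) (hR' : R ≠ ⊤) (hw : TendstoBounded w w₀) :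
    UnifIntegrable (fun n x => F x ((w n).1 x, (w n).2 x)) R μ := by
  have hP : P ≠ ⊤ := hPR ▸ ENNReal.mul_ne_top hR' ENNReal.ofReal_ne_top
  obtain ⟨M, hM⟩ := hw.bounded
  obtain ⟨K, -, hK⟩ := hF.growth M
  have second : UnifIntegrable (fun n => ((w n).2 : α → E)) P μ :=
    unifIntegrable_of_tendsto_Lp Fact.out hP (fun n => Lp.memLp _) (Lp.memLp w₀.2)
      ((Lp.tendsto_Lp_iff_tendsto_eLpNorm' _ _).1 hw.snd)
  have dominating : UnifIntegrable (fun n x => 1 + ‖(w n).2 x‖ ^ s) R μ :=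
    (unifIntegrable_const hR hR' (memLp_const 1)).add (unifIntegrable_norm_rpow hs hPR second) hR
      (fun _ => aestronglyMeasurable_const)
      fun n => (memLp_norm_rpow hs hPR (Lp.memLp (w n).2)).aestronglyMeasurable
  refine unifIntegrable_of_norm_le_mul (C := K) dominating fun n => ?_
  filter_upwards [hK, ae_norm_le_norm_Lp_top (w n).1] with x hx hwx
  exact (hx _ _ (hwx.trans (hM n))).trans_eq (by rw [Real.norm_of_nonneg (by positivity)])

theorem tendsto_toLp [hR : Fact (1 ≤ R)] (hF : IsNemytskii μ F s) (hs : 0 < s)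
    (hPR : R * ENNReal.ofReal s = P) (hR' : R ≠ ⊤) (hw : TendstoBounded w w₀) :
    Tendsto (fun n => hF.toLp hs hPR (w n)) atTop (𝓝 (hF.toLp hs hPR w₀)) := by
  refine (Lp.tendsto_Lp_iff_tendsto_eLpNorm'' _ (fun n => hF.memLp hs hPR (w n)) _
    (hF.memLp hs hPR w₀)).2 ?_
  exact tendsto_Lp_finite_of_tendstoInMeasure hR.out hR'
    (fun n => (hF.memLp hs hPR (w n)).aestronglyMeasurable) (hF.memLp hs hPR w₀)
    (hF.unifIntegrable hs hPR hR.out hR' hw)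
    (hF.tendstoInMeasure (fun n => (w n).aestronglyMeasurable) hw.tendstoInMeasure_prodMk)

end IsNemytskii

end Nemytskii

section Differentiation

theorem tendsto_coprod {ι X Y F : Type*} [NormedAddCommGroup X] [NormedSpace ℝ X]
    [NormedAddCommGroup Y] [NormedSpace ℝ Y] [NormedAddCommGroup F] [NormedSpace ℝ F]
    {l : Filter ι} {f : ι → X →L[ℝ] F} {f₀ : X →L[ℝ] F} {g : ι → Y →L[ℝ] F} {g₀ : Y →L[ℝ] F}
    (hf : Tendsto f l (𝓝 f₀)) (hg : Tendsto g l (𝓝 g₀)) :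
    Tendsto (fun i => (f i).coprod (g i)) l (𝓝 (f₀.coprod g₀)) :=
  ((ContinuousLinearMap.coprodEquivL ℝ).continuous.tendsto (f₀, g₀)).comp (hf.prodMk_nhds hg)

theorem tendsto_norm_comp_sub {ι X Y F : Type*} [NormedAddCommGroup X] [NormedSpace ℝ X]
    [NormedAddCommGroup Y] [NormedSpace ℝ Y] [NormedAddCommGroup F] [NormedSpace ℝ F]
    {l : Filter ι} {f : ι → Y →L[ℝ] F} {f₀ : Y →L[ℝ] F} (hf : Tendsto f l (𝓝 f₀))
    (L : X →L[ℝ] Y) : Tendsto (fun i => ‖(f i).comp L - f₀.comp L‖) l (𝓝 0) :=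
  tendsto_iff_norm_sub_tendsto_zero.1 <|
    ((ContinuousLinearMap.precomp F L).continuous.tendsto f₀).comp hf

theorem hasFDerivAt_of_hasLineDerivAt {X F : Type*} [NormedAddCommGroup X] [NormedSpace ℝ X]
    [NormedAddCommGroup F] [NormedSpace ℝ F] {f : X → F} {f' : X → X →L[ℝ] F} {u : X}
    (hf' : ContinuousAt f' u) (hf : ∀ u v, HasLineDerivAt ℝ f (f' u v) u v) :
    HasFDerivAt f (f' u) u := by
  rw [hasFDerivAt_iff_isLittleO_nhds_zero, Asymptotics.isLittleO_iff]
  intro ε hε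
  obtain ⟨δ, hδ, hf'δ⟩ := Metric.continuousAt_iff.1 hf' ε hε
  filter_upwards [Metric.ball_mem_nhds (0 : X) hδ] with v hv
  have deriv_line (s : ℝ) : HasDerivAt (fun s : ℝ => f (u + s • v) - s • f' u v)
      (f' (u + s • v) v - f' u v) s := by
    have shifted : HasDerivAt (fun r : ℝ => f (u + s • v + r • v)) (f' (u + s • v) v) (s - s) := by
      simpa only [sub_self, HasLineDerivAt] using hf (u + s • v) v
    have line := shifted.comp_sub_const s s
    simp only [add_assoc, ← add_smul, add_sub_cancel] at line
    have linear : HasDerivAt (fun s : ℝ => s • f' u v) (f' u v) s := by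
      simpa only [one_smul, id] using (hasDerivAt_id s).smul_const (f' u v)
    exact line.sub linear
  have deriv_le (s : ℝ) (hs : s ∈ Set.Ico (0 : ℝ) 1) : ‖f' (u + s • v) v - f' u v‖ ≤ ε * ‖v‖ := by
    rw [← _root_.sub_apply]
    refine ContinuousLinearMap.le_of_opNorm_le _ ?_ v
    rw [← dist_eq_norm]
    refine (hf'δ ?_).le
    rw [dist_self_add_left, norm_smul, Real.norm_of_nonneg hs.1]
    exact (mul_le_of_le_one_left (norm_nonneg v) hs.2.le).trans_lt (mem_ball_zero_iff.1 hv)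
  simpa [sub_right_comm] using norm_image_sub_le_of_norm_deriv_le_segment_01'
    (fun s _ => (deriv_line s).hasDerivWithinAt) deriv_le

end Differentiation

section Energy

variable {α T E : Type*} [NormedAddCommGroup T] [NormedSpace ℝ T]
  [NormedAddCommGroup E] [NormedSpace ℝ E]

/-- The partial derivative `∂H/∂t` of an integrand `H(x, t, ξ)`. -/
noncomputable def partialFst (H : α → T × E → ℝ) (x : α) (z : T × E) : T →L[ℝ] ℝ :=
  (fderiv ℝ (H x) z).comp (.inl ℝ T E)

/-- The partial derivative `∂H/∂ξ` of an integrand `H(x, t, ξ)`. -/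
noncomputable def partialSnd (H : α → T × E → ℝ) (x : α) (z : T × E) : E →L[ℝ] ℝ :=
  (fderiv ℝ (H x) z).comp (.inr ℝ T E)

theorem partialFst_add_partialSnd (H : α → T × E → ℝ) (x : α) (z v : T × E) :
    partialFst H x z v.1 + partialSnd H x z v.2 = fderiv ℝ (H x) z v := by
  simp [partialFst, partialSnd, ← map_add]

variable [MeasurableSpace α] {μ : Measure α}

/-- Integrands `H(x, t, ξ)` of class `C¹` in `(t, ξ)` with natural growth for the exponent `p`:
order `p` for `H` and `∂H/∂t`, order `p - 1` for `∂H/∂ξ`. -/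
structure IsEnergyDensity (μ : Measure α) (p : ℝ) (H : α → T × E → ℝ) : Prop where
  measurable : ∀ z, AEStronglyMeasurable (fun x => H x z) μ
  contDiff : ∀ᵐ x ∂μ, ContDiff ℝ 1 (H x)
  growth : HasGrowth μ H p
  growth_fst : HasGrowth μ (partialFst H) p
  growth_snd : HasGrowth μ (partialSnd H) (p - 1)

/-- The energy `∫ H(x, w(x)) dμ(x)` of a pair `w = (t, ξ)`. -/
noncomputable def energy {P : ℝ≥0∞} (μ : Measure α) (H : α → T × E → ℝ) (w : LpPair T E P μ) : ℝ :=
  ∫ x, H x (w.1 x, w.2 x) ∂μ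

instance fact_one_lt_conjExponent {p : ℝ} [hp : Fact (1 < p)] : Fact (1 < p.conjExponent) :=
  ⟨((Real.holderConjugate_iff_eq_conjExponent hp.out).2 rfl).symm.lt⟩

instance holderConjugate_ofReal_conjExponent {p : ℝ} [hp : Fact (1 < p)] :
    (ENNReal.ofReal p.conjExponent).HolderConjugate (ENNReal.ofReal p) :=
  ((Real.holderConjugate_iff_eq_conjExponent hp.out).2 rfl).symm.ennrealOfReal

theorem ofReal_conjExponent_mul_ofReal_sub_one {p : ℝ} (hp : 1 < p) :
    ENNReal.ofReal p.conjExponent * ENNReal.ofReal (p - 1) = ENNReal.ofReal p := by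
  have sub_pos : 0 < p - 1 := sub_pos.2 hp
  rw [← ENNReal.ofReal_mul' sub_pos.le, Real.conjExponent, div_mul_cancel₀ _ sub_pos.ne']

namespace IsEnergyDensity

variable {p : ℝ} {H : α → T × E → ℝ}

section Nemytskii

variable (h : IsEnergyDensity μ p H)
include h

theorem isNemytskii : IsNemytskii μ H p where
  measurable := h.measurable
  continuous := h.contDiff.mono fun _ hx => hx.continuous
  growth := h.growth

variable [FiniteDimensional ℝ T] [FiniteDimensional ℝ E]

theorem isNemytskii_partialFst : IsNemytskii μ (partialFst H) p where
  toCaratheodoryMap := (CaratheodoryMap.fderiv h.measurable h.contDiff).continuous_comp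
    ((ContinuousLinearMap.compL ℝ T (T × E) ℝ).flip (.inl ℝ T E)).continuous
  growth := h.growth_fst

theorem isNemytskii_partialSnd : IsNemytskii μ (partialSnd H) (p - 1) where
  toCaratheodoryMap := (CaratheodoryMap.fderiv h.measurable h.contDiff).continuous_comp
    ((ContinuousLinearMap.compL ℝ E (T × E) ℝ).flip (.inr ℝ T E)).continuous
  growth := h.growth_snd

end Nemytskii

variable [hp : Fact (1 < p)]

theorem exists_norm_fderiv_le (h : IsEnergyDensity μ p H) (M : ℝ) :
    ∃ K : ℝ, 0 ≤ K ∧ ∀ᵐ x ∂μ, ∀ (z v : T × E) (ρ : ℝ), ‖z.1‖ ≤ M → ‖v.1‖ ≤ M →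
      ‖z.2‖ ≤ ρ → ‖v.2‖ ≤ ρ → ‖fderiv ℝ (H x) z v‖ ≤ K * (1 + ρ ^ p) := by
  obtain ⟨K₁, hK₁, bound_fst⟩ := h.growth_fst M
  obtain ⟨K₂, hK₂, bound_snd⟩ := h.growth_snd M
  have p_pos : 0 < p := one_pos.trans hp.out
  refine ⟨K₁ * |M| + 2 * K₂, by positivity, ?_⟩
  filter_upwards [bound_fst, bound_snd] with x hx₁ hx₂ z v ρ hz₁ hv₁ hz₂ hv₂
  have hρ : 0 ≤ ρ := (norm_nonneg _).trans hz₂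
  have rho_le : ρ ≤ 1 + ρ ^ p := by
    rcases le_total ρ 1 with hρ1 | hρ1
    · linarith [Real.rpow_nonneg hρ p]
    · linarith [Real.self_le_rpow_of_one_le hρ1 hp.out.le]
  have rho_mul : ρ ^ (p - 1) * ρ = ρ ^ p := by
    rw [← Real.rpow_add_one' hρ (by linarith), sub_add_cancel]
  calc ‖fderiv ℝ (H x) z v‖
      ≤ ‖partialFst H x z‖ * ‖v.1‖ + ‖partialSnd H x z‖ * ‖v.2‖ := by
        rw [← partialFst_add_partialSnd]
        exact norm_add_le_of_le ((partialFst H x z).le_opNorm _) ((partialSnd H x z).le_opNorm _)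
    _ ≤ K₁ * (1 + ρ ^ p) * |M| + K₂ * (1 + ρ ^ (p - 1)) * ρ := by
        gcongr
        · exact (hx₁ z.1 z.2 hz₁).trans (by gcongr)
        · exact hv₁.trans (le_abs_self M)
        · exact (hx₂ z.1 z.2 hz₁).trans (by gcongr; linarith [hp.out])
    _ = K₁ * |M| * (1 + ρ ^ p) + K₂ * (ρ + ρ ^ p) := by rw [← rho_mul]; ring
    _ ≤ K₁ * |M| * (1 + ρ ^ p) + K₂ * ((1 + ρ ^ p) + (1 + ρ ^ p)) := by
        gcongr
        linarith
    _ = (K₁ * |M| + 2 * K₂) * (1 + ρ ^ p) := by ring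

variable [IsFiniteMeasure μ]

theorem integrable (h : IsEnergyDensity μ p H) (w : LpPair T E (ENNReal.ofReal p) μ) :
    Integrable (fun x => H x (w.1 x, w.2 x)) μ :=
  memLp_one_iff_integrable.1 <| h.isNemytskii.memLp (one_pos.trans hp.out) (one_mul _) w

theorem tendsto_energy (h : IsEnergyDensity μ p H) {w : ℕ → LpPair T E (ENNReal.ofReal p) μ}
    {w₀ : LpPair T E (ENNReal.ofReal p) μ} (hw : TendstoBounded w w₀) :
    Tendsto (fun n => energy μ H (w n)) atTop (𝓝 (energy μ H w₀)) := by
  have p_pos : 0 < p := one_pos.trans hp.out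
  have h_energy (w : LpPair T E (ENNReal.ofReal p) μ) :
      energy μ H w = ∫ x, h.isNemytskii.toLp p_pos (one_mul _) w x ∂μ :=
    integral_congr_ae (h.isNemytskii.coeFn_toLp _ _ w).symm
  simp only [h_energy]
  exact (continuous_integral.tendsto _).comp
    (h.isNemytskii.tendsto_toLp p_pos (one_mul _) ENNReal.one_ne_top hw)

theorem exists_integrable_bound_fderiv_line (h : IsEnergyDensity μ p H)
    (w v : LpPair T E (ENNReal.ofReal p) μ) :
    ∃ B : α → ℝ, Integrable B μ ∧ ∀ᵐ x ∂μ, ∀ s ∈ Metric.ball (0 : ℝ) 1,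
      ‖fderiv ℝ (H x) ((w.1 x, w.2 x) + s • (v.1 x, v.2 x)) (v.1 x, v.2 x)‖ ≤ B x := by
  obtain ⟨K, -, hK⟩ := h.exists_norm_fderiv_le (‖w.1‖ + ‖v.1‖)
  refine ⟨fun x => K * (1 + (‖w.2 x‖ + ‖v.2 x‖) ^ p), ?_, ?_⟩
  · have rho : MemLp (fun x => ‖w.2 x‖ + ‖v.2 x‖) (ENNReal.ofReal p) μ :=
      (Lp.memLp w.2).norm.add (Lp.memLp v.2).norm
    have rho_rpow := memLp_norm_rpow (one_pos.trans hp.out) (one_mul _) rho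
    simp only [Real.norm_of_nonneg (add_nonneg (norm_nonneg _) (norm_nonneg _))] at rho_rpow
    exact ((integrable_const 1).add (memLp_one_iff_integrable.1 rho_rpow)).const_mul K
  · filter_upwards [hK, ae_norm_le_norm_Lp_top w.1, ae_norm_le_norm_Lp_top v.1]
      with x hx hw₁ hv₁ s hs
    have hs : |s| ≤ 1 := (mem_ball_zero_iff.1 hs).le
    exact hx _ _ _ ((norm_add_smul_le _ _ hs).trans (add_le_add hw₁ hv₁))
      (hv₁.trans (le_add_of_nonneg_left (norm_nonneg _))) (norm_add_smul_le _ _ hs)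
      (le_add_of_nonneg_left (norm_nonneg _))

section Differential

variable [FiniteDimensional ℝ T] [FiniteDimensional ℝ E] (h : IsEnergyDensity μ p H)
include h

/-- The superposition operator of `∂H/∂t`, with values in `L¹`. -/
noncomputable def nemytskiiFst (w : LpPair T E (ENNReal.ofReal p) μ) : Lp (T →L[ℝ] ℝ) 1 μ :=
  h.isNemytskii_partialFst.toLp (one_pos.trans hp.out) (one_mul _) w

/-- The superposition operator of `∂H/∂ξ`, with values in the `L` space of the conjugate exponent
of `p`. -/
noncomputable def nemytskiiSnd (w : LpPair T E (ENNReal.ofReal p) μ) :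
    Lp (E →L[ℝ] ℝ) (ENNReal.ofReal p.conjExponent) μ :=
  h.isNemytskii_partialSnd.toLp (sub_pos.2 hp.out)
    (ofReal_conjExponent_mul_ofReal_sub_one hp.out) w

theorem nemytskiiFst_apply_ae_eq (w v : LpPair T E (ENNReal.ofReal p) μ) :
    (fun x => h.nemytskiiFst w x (v.1 x)) =ᵐ[μ]
      fun x => partialFst H x (w.1 x, w.2 x) (v.1 x) :=
  (h.isNemytskii_partialFst.coeFn_toLp (one_pos.trans hp.out) (one_mul _) w).mono
    fun x hx => congrArg (fun L => L (v.1 x)) hx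

theorem nemytskiiSnd_apply_ae_eq (w v : LpPair T E (ENNReal.ofReal p) μ) :
    (fun x => h.nemytskiiSnd w x (v.2 x)) =ᵐ[μ]
      fun x => partialSnd H x (w.1 x, w.2 x) (v.2 x) :=
  (h.isNemytskii_partialSnd.coeFn_toLp (sub_pos.2 hp.out)
    (ofReal_conjExponent_mul_ofReal_sub_one hp.out) w).mono
    fun x hx => congrArg (fun L => L (v.2 x)) hx

theorem integrable_partialFst (w v : LpPair T E (ENNReal.ofReal p) μ) :
    Integrable (fun x => partialFst H x (w.1 x, w.2 x) (v.1 x)) μ :=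
  (integrable_Lp_apply (h.nemytskiiFst w) v.1).congr (h.nemytskiiFst_apply_ae_eq w v)

theorem integrable_partialSnd (w v : LpPair T E (ENNReal.ofReal p) μ) :
    Integrable (fun x => partialSnd H x (w.1 x, w.2 x) (v.2 x)) μ :=
  (integrable_Lp_apply (h.nemytskiiSnd w) v.2).congr (h.nemytskiiSnd_apply_ae_eq w v)

/-- The differential `v ↦ ∫ ∂H/∂t(x, w) v₁ + ∂H/∂ξ(x, w) v₂` of the energy at `w`. -/
noncomputable def differential (w : LpPair T E (ENNReal.ofReal p) μ) :
    LpPair T E (ENNReal.ofReal p) μ →L[ℝ] ℝ :=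
  ((ContinuousLinearMap.id ℝ (T →L[ℝ] ℝ)).lpPairing μ 1 ∞ (h.nemytskiiFst w)).coprod
    ((ContinuousLinearMap.id ℝ (E →L[ℝ] ℝ)).lpPairing μ _ _ (h.nemytskiiSnd w))

theorem differential_apply (w v : LpPair T E (ENNReal.ofReal p) μ) :
    h.differential w v = ∫ x, fderiv ℝ (H x) (w.1 x, w.2 x) (v.1 x, v.2 x) ∂μ := by
  simp only [← partialFst_add_partialSnd,
    integral_add (h.integrable_partialFst w v) (h.integrable_partialSnd w v),
    ← integral_congr_ae (h.nemytskiiFst_apply_ae_eq w v),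
    ← integral_congr_ae (h.nemytskiiSnd_apply_ae_eq w v),
    differential, ContinuousLinearMap.coprod_apply,
    ContinuousLinearMap.lpPairing_eq_integral, ContinuousLinearMap.id_apply]

theorem tendsto_differential {w : ℕ → LpPair T E (ENNReal.ofReal p) μ}
    {w₀ : LpPair T E (ENNReal.ofReal p) μ} (hw : TendstoBounded w w₀) :
    Tendsto (fun n => h.differential (w n)) atTop (𝓝 (h.differential w₀)) := by
  have tendsto_fst : Tendsto (fun n => h.nemytskiiFst (w n)) atTop (𝓝 (h.nemytskiiFst w₀)) :=
    h.isNemytskii_partialFst.tendsto_toLp _ _ ENNReal.one_ne_top hw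
  have tendsto_snd : Tendsto (fun n => h.nemytskiiSnd (w n)) atTop (𝓝 (h.nemytskiiSnd w₀)) :=
    h.isNemytskii_partialSnd.tendsto_toLp _ _ ENNReal.ofReal_ne_top hw
  exact tendsto_coprod (((ContinuousLinearMap.continuous _).tendsto _).comp tendsto_fst)
    (((ContinuousLinearMap.continuous _).tendsto _).comp tendsto_snd)

theorem continuous_differential : Continuous h.differential :=
  continuous_iff_seqContinuous.2 fun _ _ hw =>
    h.tendsto_differential (tendstoBounded_of_tendsto hw)

theorem integrable_fderiv (w v : LpPair T E (ENNReal.ofReal p) μ) :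
    Integrable (fun x => fderiv ℝ (H x) (w.1 x, w.2 x) (v.1 x, v.2 x)) μ :=
  ((h.integrable_partialFst w v).add (h.integrable_partialSnd w v)).congr <|
    .of_forall fun x => partialFst_add_partialSnd H x (w.1 x, w.2 x) (v.1 x, v.2 x)

theorem hasLineDerivAt_energy (w v : LpPair T E (ENNReal.ofReal p) μ) :
    HasLineDerivAt ℝ (energy μ H) (h.differential w v) w v := by
  obtain ⟨B, B_integrable, fderiv_le⟩ := h.exists_integrable_bound_fderiv_line w v
  have along_line (s : ℝ) : (fun x => H x ((w + s • v).1 x, (w + s • v).2 x)) =ᵐ[μ]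
      fun x => H x ((w.1 x, w.2 x) + s • (v.1 x, v.2 x)) :=
    (w.coeFn_add_smul v s).mono fun x hx => congrArg (H x) hx
  have deriv_along_line : ∀ᵐ x ∂μ, ∀ s ∈ Metric.ball (0 : ℝ) 1,
      HasDerivAt (fun s : ℝ => H x ((w.1 x, w.2 x) + s • (v.1 x, v.2 x)))
        (fderiv ℝ (H x) ((w.1 x, w.2 x) + s • (v.1 x, v.2 x)) (v.1 x, v.2 x)) s := by
    filter_upwards [h.contDiff] with x hx s _
    have line : HasDerivAt (fun s : ℝ => (w.1 x, w.2 x) + s • (v.1 x, v.2 x)) (v.1 x, v.2 x) s := by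
      simpa only [one_smul] using
        ((hasDerivAt_id' s).smul_const (v.1 x, v.2 x)).const_add (w.1 x, w.2 x)
    exact (hx.differentiable one_ne_zero _).hasFDerivAt.comp_hasDerivAt s line
  have deriv_integral := (hasDerivAt_integral_of_dominated_loc_of_deriv_le
    (Metric.ball_mem_nhds (0 : ℝ) one_pos)
    (.of_forall fun s => ((h.integrable (w + s • v)).congr (along_line s)).aestronglyMeasurable)
    ((h.integrable (w + (0 : ℝ) • v)).congr (along_line 0))
    (by simpa only [zero_smul, add_zero] using (h.integrable_fderiv w v).aestronglyMeasurable)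
    fderiv_le B_integrable deriv_along_line).2
  simp only [← integral_congr_ae (along_line _), zero_smul, add_zero, ← h.differential_apply]
    at deriv_integral
  exact deriv_integral

theorem hasFDerivAt_energy (w : LpPair T E (ENNReal.ofReal p) μ) :
    HasFDerivAt (energy μ H) (h.differential w) w :=
  hasFDerivAt_of_hasLineDerivAt h.continuous_differential.continuousAt h.hasLineDerivAt_energy

theorem contDiff_energy :
    ContDiff ℝ 1 (energy μ H : LpPair T E (ENNReal.ofReal p) μ → ℝ) :=
  contDiff_one_iff_hasFDerivAt.2 ⟨h.differential, h.continuous_differential, h.hasFDerivAt_energy⟩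

end Differential

end IsEnergyDensity

end Energy

section Lagrangian

variable {N : ℕ} {Ω : Set (Euc N)} {p : ℝ} {A : Euc N → ℝ → Euc N → ℝ}

/-- The integrand `A(x, t, ξ)` as a function of `x` and of the pair `(t, ξ)`. -/
abbrev lagrangian (A : Euc N → ℝ → Euc N → ℝ) (x : Euc N) (z : ℝ × Euc N) : ℝ :=
  A x z.1 z.2

theorem partialFst_lagrangian {x : Euc N} (hA : ContDiff ℝ 1 (lagrangian A x)) (z : ℝ × Euc N) :
    partialFst (lagrangian A) x z = ContinuousLinearMap.toSpanSingleton ℝ (partialT A x z.1 z.2) :=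
  have slice : HasFDerivAt (fun s => A x s z.2) (partialFst (lagrangian A) x z) z.1 :=
    HasFDerivAt.comp (f := fun s => (s, z.2)) z.1
      (hA.differentiable one_ne_zero z).hasFDerivAt (hasFDerivAt_prodMk_left z.1 z.2)
  slice.unique slice.differentiableAt.hasDerivAt.hasFDerivAt

theorem partialSnd_lagrangian {x : Euc N} (hA : ContDiff ℝ 1 (lagrangian A x)) (z : ℝ × Euc N) :
    partialSnd (lagrangian A) x z = InnerProductSpace.toDual ℝ (Euc N) (gradXi A x z.1 z.2) :=
  have slice : HasFDerivAt (fun η => A x z.1 η) (partialSnd (lagrangian A) x z) z.2 :=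
    HasFDerivAt.comp (f := fun η => (z.1, η)) z.2
      (hA.differentiable one_ne_zero z).hasFDerivAt (hasFDerivAt_prodMk_right z.1 z.2)
  slice.unique slice.differentiableAt.hasGradientAt.hasFDerivAt

theorem isEnergyDensity_lagrangian (hA : IsC1Caratheodory Ω A) {Φ₀ φ₀ Φ₁ φ₁ Φ₂ φ₂ : ℝ → ℝ}
    (hΦ₀ : Continuous Φ₀) (hφ₀ : Continuous φ₀) (hΦ₁ : Continuous Φ₁) (hφ₁ : Continuous φ₁)
    (hΦ₂ : Continuous Φ₂) (hφ₂ : Continuous φ₂)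
    (hA₀ : ∀ᵐ x ∂(volOn Ω), ∀ t ξ, |A x t ξ| ≤ Φ₀ t + φ₀ t * ‖ξ‖ ^ p)
    (hA₁ : ∀ᵐ x ∂(volOn Ω), ∀ t ξ, |partialT A x t ξ| ≤ Φ₁ t + φ₁ t * ‖ξ‖ ^ p)
    (hA₂ : ∀ᵐ x ∂(volOn Ω), ∀ t ξ, ‖gradXi A x t ξ‖ ≤ Φ₂ t + φ₂ t * ‖ξ‖ ^ (p - 1)) :
    IsEnergyDensity (volOn Ω) p (lagrangian A) where
  measurable z := (hA.measurable z.1 z.2).aestronglyMeasurable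
  contDiff := hA.contDiff
  growth := hasGrowth_of_norm_le hΦ₀ hφ₀ hA₀
  growth_fst := by
    refine hasGrowth_of_norm_le hΦ₁ hφ₁ ?_
    filter_upwards [hA.contDiff, hA₁] with x hx hAx t ξ
    rw [partialFst_lagrangian hx, ContinuousLinearMap.norm_toSpanSingleton]
    exact hAx t ξ
  growth_snd := by
    refine hasGrowth_of_norm_le hΦ₂ hφ₂ ?_
    filter_upwards [hA.contDiff, hA₂] with x hx hAx t ξ
    rw [partialSnd_lagrangian hx, LinearIsometryEquiv.norm_map]
    exact hAx t ξ

namespace IsEnergyDensity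

variable [Fact (1 < p)] [IsFiniteMeasure (volOn Ω)]
  (hA : IsEnergyDensity (volOn Ω) p (lagrangian A))
  (w v : LpPair ℝ (Euc N) (ENNReal.ofReal p) (volOn Ω))
include hA

theorem integrable_partialT_mul :
    Integrable (fun x => partialT A x (w.1 x) (w.2 x) * v.1 x) (volOn Ω) := by
  refine (hA.integrable_partialFst w v).congr ?_
  filter_upwards [hA.contDiff] with x hx
  rw [partialFst_lagrangian hx, ContinuousLinearMap.toSpanSingleton_apply, smul_eq_mul, mul_comm]

theorem integrable_inner_gradXi :
    Integrable (fun x => inner ℝ (gradXi A x (w.1 x) (w.2 x)) (v.2 x)) (volOn Ω) := by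
  refine (hA.integrable_partialSnd w v).congr ?_
  filter_upwards [hA.contDiff] with x hx
  rw [partialSnd_lagrangian hx, InnerProductSpace.toDual_apply_apply]

theorem differential_lagrangian_apply :
    hA.differential w v = ∫ x, (inner ℝ (gradXi A x (w.1 x) (w.2 x)) (v.2 x)
      + partialT A x (w.1 x) (w.2 x) * v.1 x) ∂(volOn Ω) := by
  rw [hA.differential_apply]
  refine integral_congr_ae ?_
  filter_upwards [hA.contDiff] with x hx
  rw [← partialFst_add_partialSnd, partialFst_lagrangian hx, partialSnd_lagrangian hx,
    ContinuousLinearMap.toSpanSingleton_apply, InnerProductSpace.toDual_apply_apply, smul_eq_mul,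
    add_comm, mul_comm]

end IsEnergyDensity

end Lagrangian

section Primitive

variable {N : ℕ} {Ω : Set (Euc N)} {g : Euc N → ℝ → ℝ}

theorem hasDerivAt_primitiveG {x : Euc N} (hg : Continuous (g x)) (t : ℝ) :
    HasDerivAt (primitiveG g x) (g x t) t :=
  intervalIntegral.integral_hasDerivAt_right (hg.intervalIntegrable _ _)
    (hg.stronglyMeasurableAtFilter _ _) hg.continuousAt

theorem contDiff_primitiveG {x : Euc N} (hg : Continuous (g x)) :
    ContDiff ℝ 1 (primitiveG g x) := by
  have deriv_eq : deriv (primitiveG g x) = g x := funext fun t => (hasDerivAt_primitiveG hg t).deriv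
  exact contDiff_one_iff_deriv.2
    ⟨fun t => (hasDerivAt_primitiveG hg t).differentiableAt, deriv_eq ▸ hg⟩

theorem aestronglyMeasurable_setIntegral (hg : IsCaratheodory Ω g) (S : Set ℝ) :
    AEStronglyMeasurable (fun x => ∫ s in S, g x s) (volOn Ω) := by
  have on_product : CaratheodoryMap ((volOn Ω).prod (volume.restrict S))
      (fun (y : Euc N × ℝ) t => g y.1 t) :=
    ⟨fun t => (hg.measurable t).aestronglyMeasurable.comp_fst,
      Measure.quasiMeasurePreserving_fst.ae hg.continuous⟩
  exact (on_product.comp_aestronglyMeasurable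
    measurable_snd.aestronglyMeasurable).integral_prod_right'

/-- The primitive `G(x, t)` as an integrand `A(x, t, ξ)` which does not depend on `ξ`. -/
noncomputable abbrev primitiveIntegrand (g : Euc N → ℝ → ℝ) (x : Euc N) (t : ℝ) (_ξ : Euc N) : ℝ :=
  primitiveG g x t

theorem partialT_primitiveIntegrand {x : Euc N} (hg : Continuous (g x)) (t : ℝ) (ξ : Euc N) :
    partialT (primitiveIntegrand g) x t ξ = g x t :=
  (hasDerivAt_primitiveG hg t).deriv

theorem gradXi_primitiveIntegrand (x : Euc N) (t : ℝ) (ξ : Euc N) :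
    gradXi (primitiveIntegrand g) x t ξ = 0 :=
  gradient_const ξ (primitiveG g x t)

theorem isC1Caratheodory_primitiveIntegrand (hg : IsCaratheodory Ω g) :
    IsC1Caratheodory Ω (primitiveIntegrand g) where
  measurable _ _ := ((aestronglyMeasurable_setIntegral hg _).sub
    (aestronglyMeasurable_setIntegral hg _)).aemeasurable
  contDiff := hg.continuous.mono fun _ hx => (contDiff_primitiveG hx).comp contDiff_fst

theorem isEnergyDensity_primitiveIntegrand (hg : IsCaratheodory Ω g) {Ψ : ℝ → ℝ}
    (hΨ : Continuous Ψ) (hgΨ : ∀ᵐ x ∂(volOn Ω), ∀ t, |g x t| ≤ Ψ t) (p : ℝ) :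
    IsEnergyDensity (volOn Ω) p (lagrangian (primitiveIntegrand g)) := by
  refine isEnergyDensity_lagrangian (isC1Caratheodory_primitiveIntegrand hg)
    (continuous_abs.comp
      (intervalIntegral.continuous_primitive (μ := volume) hΨ.intervalIntegrable 0))
    (continuous_const (y := 0)) hΨ (continuous_const (y := 0)) (continuous_const (y := 0))
    (continuous_const (y := 0)) ?_ ?_ ?_
  · filter_upwards [hgΨ] with x hx t ξ
    rw [zero_mul, add_zero]
    exact intervalIntegral.norm_integral_le_abs_of_norm_le (f := g x) (.of_forall hx)
      (hΨ.intervalIntegrable 0 t)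
  · filter_upwards [hg.continuous, hgΨ] with x hx hgx t ξ
    simpa only [partialT_primitiveIntegrand hx, zero_mul, add_zero] using hgx t
  · exact .of_forall fun x t ξ => by simp [gradXi_primitiveIntegrand]

variable {p : ℝ} [Fact (1 < p)] [IsFiniteMeasure (volOn Ω)]

theorem integrable_mul_of_primitiveIntegrand (hg : IsCaratheodory Ω g)
    (hG : IsEnergyDensity (volOn Ω) p (lagrangian (primitiveIntegrand g)))
    (w v : LpPair ℝ (Euc N) (ENNReal.ofReal p) (volOn Ω)) :
    Integrable (fun x => g x (w.1 x) * v.1 x) (volOn Ω) := by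
  refine (hG.integrable_partialT_mul w v).congr ?_
  filter_upwards [hg.continuous] with x hx
  rw [partialT_primitiveIntegrand hx]

theorem differential_primitiveIntegrand_apply (hg : IsCaratheodory Ω g)
    (hG : IsEnergyDensity (volOn Ω) p (lagrangian (primitiveIntegrand g)))
    (w v : LpPair ℝ (Euc N) (ENNReal.ofReal p) (volOn Ω)) :
    hG.differential w v = ∫ x, g x (w.1 x) * v.1 x ∂(volOn Ω) := by
  rw [hG.differential_lagrangian_apply]
  refine integral_congr_ae ?_
  filter_upwards [hg.continuous] with x hx
  rw [partialT_primitiveIntegrand hx, gradXi_primitiveIntegrand, inner_zero_left, zero_add]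

end Primitive

section SpaceX

variable {N : ℕ} {Ω : Set (Euc N)} {p : ℝ} [Fact (1 < p)]

/-- The embedding `u ↦ (u, ∇u)` of `X` into `L^∞ × L^p`. -/
noncomputable def spaceX.valGrad (Ω : Set (Euc N)) (p : ℝ) [Fact (1 < p)] :
    spaceX Ω p →L[ℝ] LpPair ℝ (Euc N) (ENNReal.ofReal p) (volOn Ω) :=
  ((ContinuousLinearEquiv.prodComm ℝ _ _).toContinuousLinearMap.comp
    (WithLp.prodContinuousLinearEquiv 1 ℝ _ _).toContinuousLinearMap).comp (spaceX Ω p).subtypeL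

theorem tendstoBounded_valGrad [IsFiniteMeasure (volOn Ω)] {u : ℕ → spaceX Ω p} {u₀ : spaceX Ω p}
    (hgrad : Tendsto (fun n => normW (u n - u₀)) atTop (𝓝 0))
    (hval : ∀ᵐ x ∂(volOn Ω),
      Tendsto (fun n => spaceX.val (u n) x) atTop (𝓝 (spaceX.val u₀ x)))
    (hbdd : ∃ M : ℝ, 0 < M ∧ ∀ n, normInfty (u n) ≤ M) :
    TendstoBounded (fun n => spaceX.valGrad Ω p (u n)) (spaceX.valGrad Ω p u₀) where
  bounded := hbdd.imp fun _ hM => hM.2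
  fst := tendstoInMeasure_of_tendsto_ae (fun _ => Lp.aestronglyMeasurable _) hval
  snd := tendsto_iff_norm_sub_tendsto_zero.2 hgrad

theorem functionalJ_eq_energy_sub_energy (A : Euc N → ℝ → Euc N → ℝ) (g : Euc N → ℝ → ℝ)
    (u : spaceX Ω p) :
    functionalJ A g u = energy (volOn Ω) (lagrangian A) (spaceX.valGrad Ω p u)
      - energy (volOn Ω) (lagrangian (primitiveIntegrand g)) (spaceX.valGrad Ω p u) :=
  rfl

variable [IsFiniteMeasure (volOn Ω)] {A : Euc N → ℝ → Euc N → ℝ} {g : Euc N → ℝ → ℝ}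
  (hA : IsEnergyDensity (volOn Ω) p (lagrangian A))
  (hG : IsEnergyDensity (volOn Ω) p (lagrangian (primitiveIntegrand g)))

/-- The differential `dJ(u)` as an element of the dual of `X`. -/
noncomputable def fderivJ (u : spaceX Ω p) : spaceX Ω p →L[ℝ] ℝ :=
  (hA.differential (spaceX.valGrad Ω p u) - hG.differential (spaceX.valGrad Ω p u)).comp
    (spaceX.valGrad Ω p)

theorem fderivJ_apply (hg : IsCaratheodory Ω g) (u v : spaceX Ω p) :
    fderivJ hA hG u v = differentialJ A g u v :=
  congrArg₂ (· - ·)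
    (hA.differential_lagrangian_apply (spaceX.valGrad Ω p u) (spaceX.valGrad Ω p v))
    (differential_primitiveIntegrand_apply hg hG (spaceX.valGrad Ω p u) (spaceX.valGrad Ω p v))

theorem hasFDerivAt_functionalJ (u : spaceX Ω p) :
    HasFDerivAt (functionalJ A g) (fderivJ hA hG u) u := by
  simp only [funext (functionalJ_eq_energy_sub_energy A g)]
  exact HasFDerivAt.comp (f := spaceX.valGrad Ω p) u
    ((hA.hasFDerivAt_energy _).sub (hG.hasFDerivAt_energy _)) (spaceX.valGrad Ω p).hasFDerivAt

include hA hG in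
theorem contDiff_functionalJ : ContDiff ℝ 1 (functionalJ A g : spaceX Ω p → ℝ) := by
  simp only [funext (functionalJ_eq_energy_sub_energy A g)]
  exact ContDiff.comp (f := spaceX.valGrad Ω p) (hA.contDiff_energy.sub hG.contDiff_energy)
    (spaceX.valGrad Ω p).contDiff

variable {u : ℕ → spaceX Ω p} {u₀ : spaceX Ω p}
  (hu : TendstoBounded (fun n => spaceX.valGrad Ω p (u n)) (spaceX.valGrad Ω p u₀))
include hu

include hA hG in
theorem tendsto_functionalJ :
    Tendsto (fun n => functionalJ A g (u n)) atTop (𝓝 (functionalJ A g u₀)) := by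
  simp only [functionalJ_eq_energy_sub_energy]
  exact (hA.tendsto_energy hu).sub (hG.tendsto_energy hu)

theorem tendsto_norm_fderivJ_sub :
    Tendsto (fun n => ‖fderivJ hA hG (u n) - fderivJ hA hG u₀‖) atTop (𝓝 0) :=
  tendsto_norm_comp_sub
    ((hA.tendsto_differential hu).sub (hG.tendsto_differential hu)) (spaceX.valGrad Ω p)

end SpaceX

theorem proposition3_general {N : ℕ} (Ω : Set (Euc N)) [IsFiniteMeasure (volOn Ω)] (p : ℝ)
    [Fact (1 < p)] (A : Euc N → ℝ → Euc N → ℝ) (g : Euc N → ℝ → ℝ)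
    (hA : IsC1Caratheodory Ω A) (Φ₀ φ₀ Φ₁ φ₁ Φ₂ φ₂ : ℝ → ℝ)
    (hΦ₀ : Continuous Φ₀) (hφ₀ : Continuous φ₀) (hΦ₁ : Continuous Φ₁) (hφ₁ : Continuous φ₁)
    (hΦ₂ : Continuous Φ₂) (hφ₂ : Continuous φ₂)
    (hA₀ : ∀ᵐ x ∂(volOn Ω), ∀ (t : ℝ) (ξ : Euc N), |A x t ξ| ≤ Φ₀ t + φ₀ t * ‖ξ‖ ^ p)
    (hA₁ : ∀ᵐ x ∂(volOn Ω), ∀ (t : ℝ) (ξ : Euc N),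
      |partialT A x t ξ| ≤ Φ₁ t + φ₁ t * ‖ξ‖ ^ p)
    (hA₂ : ∀ᵐ x ∂(volOn Ω), ∀ (t : ℝ) (ξ : Euc N),
      ‖gradXi A x t ξ‖ ≤ Φ₂ t + φ₂ t * ‖ξ‖ ^ (p - 1))
    (hg : IsCaratheodory Ω g) (Ψ : ℝ → ℝ) (hΨ : Continuous Ψ)
    (hgΨ : ∀ᵐ x ∂(volOn Ω), ∀ t : ℝ, |g x t| ≤ Ψ t) :
    (∀ u v : spaceX Ω p,
      Integrable (fun x => A x (spaceX.val u x) (spaceX.grad u x)) (volOn Ω) ∧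
      Integrable (fun x => primitiveG g x (spaceX.val u x)) (volOn Ω) ∧
      Integrable (fun x => (inner ℝ (gradXi A x (spaceX.val u x) (spaceX.grad u x))
        (spaceX.grad v x) : ℝ)) (volOn Ω) ∧
      Integrable (fun x => partialT A x (spaceX.val u x) (spaceX.grad u x) * spaceX.val v x)
        (volOn Ω) ∧
      Integrable (fun x => g x (spaceX.val u x) * spaceX.val v x) (volOn Ω)) ∧
    ∃ dJ : spaceX Ω p → (spaceX Ω p →L[ℝ] ℝ),
      (∀ u v : spaceX Ω p, dJ u v = differentialJ A g u v) ∧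
      (∀ (u : ℕ → spaceX Ω p) (u₀ : spaceX Ω p),
        Tendsto (fun n => normW (u n - u₀)) atTop (𝓝 0) →
        (∀ᵐ x ∂(volOn Ω), Tendsto (fun n => spaceX.val (u n) x) atTop (𝓝 (spaceX.val u₀ x))) →
        (∃ M : ℝ, 0 < M ∧ ∀ n, normInfty (u n) ≤ M) →
        Tendsto (fun n => functionalJ A g (u n)) atTop (𝓝 (functionalJ A g u₀)) ∧
        Tendsto (fun n => ‖dJ (u n) - dJ u₀‖) atTop (𝓝 0)) ∧
      (∀ u : spaceX Ω p, HasFDerivAt (functionalJ A g : spaceX Ω p → ℝ) (dJ u) u) ∧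
      ContDiff ℝ 1 (functionalJ A g : spaceX Ω p → ℝ) := by
  have densityA : IsEnergyDensity (volOn Ω) p (lagrangian A) :=
    isEnergyDensity_lagrangian hA hΦ₀ hφ₀ hΦ₁ hφ₁ hΦ₂ hφ₂ hA₀ hA₁ hA₂
  have densityG := isEnergyDensity_primitiveIntegrand hg hΨ hgΨ p
  refine ⟨fun u v => ?_, fderivJ densityA densityG, fderivJ_apply densityA densityG hg,
    fun u u₀ hgrad hval hbdd => ?_, hasFDerivAt_functionalJ densityA densityG,
    contDiff_functionalJ densityA densityG⟩
  · let w (u : spaceX Ω p) := spaceX.valGrad Ω p u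
    exact ⟨densityA.integrable (w u), densityG.integrable (w u),
      densityA.integrable_inner_gradXi (w u) (w v), densityA.integrable_partialT_mul (w u) (w v),
      integrable_mul_of_primitiveIntegrand hg densityG (w u) (w v)⟩
  · have hu := tendstoBounded_valGrad hgrad hval hbdd
    exact ⟨tendsto_functionalJ densityA densityG hu,
      tendsto_norm_fderivJ_sub densityA densityG hu⟩

theorem proposition3 {N : ℕ} (hN : 2 ≤ N) (Ω : Set (Euc N)) (hΩ : IsOpen Ω)
    (hΩb : Bornology.IsBounded Ω) (p : ℝ) [Fact (1 < p)]
    (A : Euc N → ℝ → Euc N → ℝ) (g : Euc N → ℝ → ℝ)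
    (hA : IsC1Caratheodory Ω A)
    (Φ₀ φ₀ Φ₁ φ₁ Φ₂ φ₂ : ℝ → ℝ)
    (hΦ₀ : Continuous Φ₀ ∧ ∀ t, 0 < Φ₀ t) (hφ₀ : Continuous φ₀ ∧ ∀ t, 0 < φ₀ t)
    (hΦ₁ : Continuous Φ₁ ∧ ∀ t, 0 < Φ₁ t) (hφ₁ : Continuous φ₁ ∧ ∀ t, 0 < φ₁ t)
    (hΦ₂ : Continuous Φ₂ ∧ ∀ t, 0 < Φ₂ t) (hφ₂ : Continuous φ₂ ∧ ∀ t, 0 < φ₂ t)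
    (hA₀ : ∀ᵐ x ∂(volOn Ω), ∀ (t : ℝ) (ξ : Euc N), |A x t ξ| ≤ Φ₀ t + φ₀ t * ‖ξ‖ ^ p)
    (hA₁ : ∀ᵐ x ∂(volOn Ω), ∀ (t : ℝ) (ξ : Euc N),
      |partialT A x t ξ| ≤ Φ₁ t + φ₁ t * ‖ξ‖ ^ p)
    (hA₂ : ∀ᵐ x ∂(volOn Ω), ∀ (t : ℝ) (ξ : Euc N),
      ‖gradXi A x t ξ‖ ≤ Φ₂ t + φ₂ t * ‖ξ‖ ^ (p - 1))
    (hg : IsCaratheodory Ω g)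
    (a₁ a₂ q : ℝ) (ha₁ : 0 < a₁) (ha₂ : 0 < a₂) (hq : 1 ≤ q)
    (hg₁ : ∀ᵐ x ∂(volOn Ω), ∀ t : ℝ, |g x t| ≤ a₁ + a₂ * |t| ^ (q - 1)) :
    -- all the integrals in `J(u)` and `⟨dJ(u), v⟩` converge
    (∀ u v : spaceX Ω p,
      Integrable (fun x => A x (spaceX.val u x) (spaceX.grad u x)) (volOn Ω) ∧
      Integrable (fun x => primitiveG g x (spaceX.val u x)) (volOn Ω) ∧
      Integrable (fun x => (inner ℝ (gradXi A x (spaceX.val u x) (spaceX.grad u x))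
        (spaceX.grad v x) : ℝ)) (volOn Ω) ∧
      Integrable (fun x => partialT A x (spaceX.val u x) (spaceX.grad u x) * spaceX.val v x)
        (volOn Ω) ∧
      Integrable (fun x => g x (spaceX.val u x) * spaceX.val v x) (volOn Ω)) ∧
    ∃ dJ : spaceX Ω p → (spaceX Ω p →L[ℝ] ℝ),
      (∀ u v : spaceX Ω p, dJ u v = differentialJ A g u v) ∧
      (∀ (u : ℕ → spaceX Ω p) (u₀ : spaceX Ω p),
        Tendsto (fun n => normW (u n - u₀)) atTop (𝓝 0) →
        (∀ᵐ x ∂(volOn Ω), Tendsto (fun n => spaceX.val (u n) x) atTop (𝓝 (spaceX.val u₀ x))) →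
        (∃ M : ℝ, 0 < M ∧ ∀ n, normInfty (u n) ≤ M) →
        Tendsto (fun n => functionalJ A g (u n)) atTop (𝓝 (functionalJ A g u₀)) ∧
        Tendsto (fun n => ‖dJ (u n) - dJ u₀‖) atTop (𝓝 0)) ∧
      (∀ u : spaceX Ω p, HasFDerivAt (functionalJ A g : spaceX Ω p → ℝ) (dJ u) u) ∧
      ContDiff ℝ 1 (functionalJ A g : spaceX Ω p → ℝ) := by
  have : IsFiniteMeasure (volOn Ω) := isFiniteMeasure_restrict.2 hΩb.measure_lt_top.ne
  exact proposition3_general Ω p A g hA Φ₀ φ₀ Φ₁ φ₁ Φ₂ φ₂ hΦ₀.1 hφ₀.1 hΦ₁.1 hφ₁.1 hΦ₂.1 hφ₂.1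
    hA₀ hA₁ hA₂ hg _ (continuous_const.add <| continuous_const.mul <|
      continuous_abs.rpow_const fun _ => Or.inr (by linarith)) hg₁
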